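/- Let $\mathbb A$ be a countably infinite set (of atoms). Let $\mathrm{Sb}$ be the monoid (under composition) of all functions $m\colon\mathbb A\to\mathbb A$ with $m(a)\neq a$ for only finitely many $a$, and $\mathrm{Pm}\subseteq\mathrm{Sb}$ the group of bijective ones. For $M\in\{\mathrm{Pm},\mathrm{Sb}\}$ and an $M$-set $X$, a set $C\subseteq\mathbb A$ is an $M$-support of $x\in X$ if $m_1|_C=m_2|_C$ implies $m_1x=m_2x$ for all $m_1,m_2\in M$; $X$ is nominal if each element has a finite $M$-support. Let $M\text{-}\mathbf{Nom}$ be the category of nominal $M$-sets and $M$-equivariant maps. In a nominal $\mathrm{Pm}$-set, $\mathrm{supp}(x)$ denotes the least finite support of $x$; elements $x,y$ of $\mathrm{Pm}$-sets are separated, $x\mathrel\#y$, if they have disjoint finite supports. * $U\colon\mathrm{Sb}\text{-}\mathbf{Nom}\to\mathrm{Pm}\text{-}\mathbf{Nom}$ is the forgetful functor (restriction of the action). * $F\colon\mathrm{Pm}\text{-}\mathbf{Nom}\to\mathrm{Sb}\text{-}\mathbf{Nom}$ sends $X$ to $F(X)=(\mathrm{Sb}\times X)/{\sim}$, where $\sim$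 is the least equivalence relation with $(m,gx)\sim(mg,x)$ for $g\in\mathrm{Pm}$, and $(m,x)\sim(m',x)$ whenever $m|_C=m'|_C$ for a finite $\mathrm{Pm}$-support $C$ of $x$; the action is $n\cdot[m,x]=[nm,x]$, and $F(f)[m,x]=[m,f(x)]$. The functor $F$ is left adjoint to $U$, with unit $x\mapsto[\mathrm{id},x]$ and counit $[m,y]\mapsto m\cdot y$. * For nominal $\mathrm{Pm}$-sets $X,Y$, the magic wand $X\mathbin{-\!*}Y$ is the set of partial functions $f\colon X\rightharpoonup Y$ that are finitely supported with respect to the action $(g\cdot f)(x)=g\cdot f(g^{-1}x)$, are such that $f(x)$ is defined if and only if $f\mathrel\#x$, and satisfy $\mathrm{supp}(f)=\bigcup_{x\in\mathrm{dom}(f)}\mathrm{supp}(f(x))\setminus\mathrm{supp}(x)$. An equivariant $h\colon Y\to Z$ sends $f\in X\mathbin{-\!*}Y$ to the unique element of $X\mathbin{-\!*}Z$ that extends $h\circ f$. * For nominal $\mathrm{Sb}$-sets $X,Y$, the exponent $X\to_{\mathrm{Sb}}Y$ is the set of finitely supported elements of the $\mathrm{Sb}$-set of all equivariant maps $f\colon\mathrm{Sb}\times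 X\to Y$ with action $(m\cdot f)(n,x)=f(nm,x)$; equivariant maps $Y\to Z$ act by post-composition. Let $\Sigma$ be a nominal $\mathrm{Pm}$-set and $O$ a nominal $\mathrm{Sb}$-set, and define the endofunctors $S(X)=UO\times(\Sigma\mathbin{-\!*}X)$ of $\mathrm{Pm}\text{-}\mathbf{Nom}$ and $B_{\mathrm{Sb}}(X)=O\times(F\Sigma\to_{\mathrm{Sb}}X)$ of $\mathrm{Sb}\text{-}\mathbf{Nom}$. **Theorem 4.12.** The adjunction $F\dashv U$ lifts to categories of coalgebras: there are functors $\overline F\colon\mathrm{CoAlg}(S)\to\mathrm{CoAlg}(B_{\mathrm{Sb}})$ and $\overline U\colon\mathrm{CoAlg}(B_{\mathrm{Sb}})\to\mathrm{CoAlg}(S)$ and an adjunction $\overline F\dashv\overline U$ such that $\overline F$ and $\overline U$ coincide with $F$ and $U$ on carriers and on underlying maps, and the unit and the counit of $\overline F\dashv\overline U$ have as underlying maps those of $F\dashv U$. -/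

import Mathlib

open CategoryTheory

universe u

namespace Nominal

/-! ### Substitutions, permutations, supports -/

/-- The monoid `Sb` of finite substitutions of the set `A` of atoms: functions `m : A → A` with
`m a ≠ a` for only finitely many `a`, multiplication being composition. -/
def Sb (A : Type) : Submonoid (Function.End A) where
  carrier := {m | {a : A | m a ≠ a}.Finite}
  one_mem' := by
    have h : {a : A | (1 : Function.End A) a ≠ a} = ∅ := by
      ext a; simp [Function.End.one_def]
    rw [Set.mem_ofPred_eq, h]; exact Set.finite_empty
  mul_mem' := by
    intro m n hm hn
    refine (Set.Finite.union hm hn).subset ?_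
    intro a ha
    by_contra hc
    simp only [Set.mem_union, Set.mem_ofPred_eq, not_or, not_not] at hc
    apply ha
    change m (n a) = a
    rw [hc.2, hc.1]

/-- The monoid `Pm` of finite permutations: the bijective finite substitutions. -/
def Pm (A : Type) : Submonoid (Function.End A) where
  carrier := {m | m ∈ Sb A ∧ Function.Bijective m}
  one_mem' := ⟨(Sb A).one_mem, Function.bijective_id⟩
  mul_mem' := fun hm hn => ⟨(Sb A).mul_mem hm.1 hn.1, hm.2.comp hn.2⟩

theorem Pm_le_Sb (A : Type) : Pm A ≤ Sb A := fun _ h => h.1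

/-- The inclusion of finite permutations into finite substitutions. -/
def incl (A : Type) : Pm A →* Sb A := Submonoid.inclusion (Pm_le_Sb A)

/-- Finite permutations form a group, the inverse being the inverse function. -/
noncomputable instance (A : Type) : Group (Pm A) :=
  { (inferInstance : Monoid (Pm A)) with
    inv := fun g => ⟨((Equiv.ofBijective g.1 g.2.2).symm : A → A), by
      refine ⟨Set.Finite.subset g.2.1 ?_, Equiv.bijective _⟩
      intro a ha hga
      apply ha
      exact (Equiv.symm_apply_eq (Equiv.ofBijective g.1 g.2.2)).2 hga.symm⟩
    inv_mul_cancel := fun g => by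
      apply Subtype.ext
      funext a
      exact (Equiv.ofBijective g.1 g.2.2).symm_apply_apply a }

section Support

variable {A : Type} (M : Submonoid (Function.End A)) {X : Type u} [MulAction M X]

/-- `C` is an `M`-support of `x` if elements of `M` that agree on `C` act in the same way on `x`. -/
def IsSupport (C : Set A) (x : X) : Prop :=
  ∀ m₁ m₂ : M, (∀ a ∈ C, m₁.1 a = m₂.1 a) → m₁ • x = m₂ • x

/-- `x` has a finite `M`-support. -/
def HasFiniteSupport (x : X) : Prop :=
  ∃ C : Set A, C.Finite ∧ IsSupport M C x

/-- The least finite `M`-support of `x`, as the intersection of all finite supports. -/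
def supp (x : X) : Set A :=
  ⋂₀ {C : Set A | C.Finite ∧ IsSupport M C x}

/-- `x` and `y` are separated if they have disjoint finite supports. -/
def Separated {Y : Type u} [MulAction M Y] (x : X) (y : Y) : Prop :=
  ∃ C D : Set A, C.Finite ∧ D.Finite ∧ Disjoint C D ∧ IsSupport M C x ∧ IsSupport M D y

variable {M}

theorem IsSupport.mono {C D : Set A} {x : X} (h : IsSupport M C x) (hCD : C ⊆ D) :
    IsSupport M D x := fun _ _ hm => h _ _ fun a ha => hm a (hCD ha)

theorem IsSupport.smul {C : Set A} {x : X} (h : IsSupport M C x) (m : M) :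
    IsSupport M (m.1 '' C) (m • x) := by
  intro m₁ m₂ hm
  rw [← mul_smul, ← mul_smul]
  exact h _ _ fun a ha => hm _ ⟨a, ha, rfl⟩

theorem HasFiniteSupport.smul {x : X} (h : HasFiniteSupport M x) (m : M) :
    HasFiniteSupport M (m • x) := by
  obtain ⟨C, hC, hx⟩ := h
  exact ⟨_, hC.image _, hx.smul m⟩

theorem IsSupport.map {Y : Type u} [MulAction M Y] {C : Set A} {x : X} (h : IsSupport M C x)
    (f : X →[M] Y) : IsSupport M C (f x) := by
  intro m₁ m₂ hm
  rw [← map_smul, ← map_smul, h _ _ hm]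

end Support

/-! ### The category of nominal `M`-sets -/

/-- A nominal `M`-set: a set with an `M`-action all of whose elements have a finite support. -/
structure NomSet {A : Type} (M : Submonoid (Function.End A)) : Type (u + 1) where
  carrier : Type u
  [action : MulAction M carrier]
  nominal : ∀ x : carrier, HasFiniteSupport M x

attribute [instance] NomSet.action

section Category

variable {A : Type} {M : Submonoid (Function.End A)}

/-- Morphisms of nominal `M`-sets are the equivariant maps. -/
instance : Category.{u} (NomSet.{u} M) where
  Hom X Y := X.carrier →[M] Y.carrier
  id X := MulActionHom.id M
  comp f g := MulActionHom.comp g f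

/-- The underlying function of a morphism of nominal sets. -/
def NomSet.fn {X Y : NomSet.{u} M} (f : X ⟶ Y) : X.carrier → Y.carrier :=
  fun x => MulActionHom.toFun f x

theorem NomSet.hom_ext {X Y : NomSet.{u} M} {f g : X ⟶ Y}
    (h : ∀ x, NomSet.fn f x = NomSet.fn g x) : f = g :=
  MulActionHom.ext h

theorem NomSet.fn_smul {X Y : NomSet.{u} M} (f : X ⟶ Y) (m : M) (x : X.carrier) :
    NomSet.fn f (m • x) = m • NomSet.fn f x :=
  MulActionHom.map_smul' f m x

theorem NomSet.isSupport_fn {X Y : NomSet.{u} M} (f : X ⟶ Y) {C : Set A} {x : X.carrier}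
    (h : IsSupport M C x) : IsSupport M C (NomSet.fn f x) :=
  IsSupport.map h (show X.carrier →[M] Y.carrier from f)

/-- A morphism of nominal sets from an equivariant function. -/
def NomSet.homMk {X Y : NomSet.{u} M} (f : X.carrier → Y.carrier)
    (hf : ∀ (m : M) (x : X.carrier), f (m • x) = m • f x) : X ⟶ Y :=
  (⟨f, hf⟩ : X.carrier →[M] Y.carrier)

/-- The action of `M` on the finitely supported elements of an `M`-set. -/
instance (X : Type u) [MulAction M X] : MulAction M {x : X // HasFiniteSupport M x} where
  smul m x := ⟨m • x.1, x.2.smul m⟩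
  one_smul x := Subtype.ext (one_smul M x.1)
  mul_smul m n x := Subtype.ext (mul_smul m n x.1)

theorem isSupport_subtype {X : Type u} [MulAction M X] {C : Set A}
    {x : {x : X // HasFiniteSupport M x}} : IsSupport M C x ↔ IsSupport M C x.1 :=
  ⟨fun h m n hmn => congrArg Subtype.val (h m n hmn), fun h m n hmn => Subtype.ext (h m n hmn)⟩

/-- The nominal `M`-set of finitely supported elements of an `M`-set. -/
def nominalPart (M : Submonoid (Function.End A)) (X : Type u) [MulAction M X] : NomSet.{u} M where
  carrier := {x : X // HasFiniteSupport M x}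
  nominal x := by
    obtain ⟨C, hC, hx⟩ := x.2
    exact ⟨C, hC, isSupport_subtype.2 hx⟩

/-- The functor `X ↦ O × X`, with the pointwise action on the Cartesian product. -/
def prodFunctor (O : NomSet.{u} M) : NomSet.{u} M ⥤ NomSet.{u} M where
  obj X :=
    { carrier := O.carrier × X.carrier
      nominal := fun p => by
        obtain ⟨C, hC, h₁⟩ := O.nominal p.1
        obtain ⟨D, hD, h₂⟩ := X.nominal p.2
        exact ⟨C ∪ D, hC.union hD, fun m n h => Prod.ext
          (h₁ m n fun a ha => h a (Or.inl ha)) (h₂ m n fun a ha => h a (Or.inr ha))⟩ }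
  map f := NomSet.homMk (fun p => (p.1, NomSet.fn f p.2)) fun m p =>
    Prod.ext rfl (NomSet.fn_smul f m p.2)

/-! ### The exponent of nominal `M`-sets -/

/-- The action of `M` on equivariant maps `f : M × X → Y`, given by `(m • f) (n, x) = f (n m, x)`.
Here `M` acts diagonally on `M × X`, and on itself by multiplication from the left. -/
instance expAction (X Y : Type u) [MulAction M X] [MulAction M Y] :
    MulAction M ((M × X) →[M] Y) where
  smul m f := ⟨fun p => f (p.1 * m, p.2), fun k p => by
    have h := map_smul f k (p.1 * m, p.2)
    refine Eq.trans ?_ h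
    change f (k * p.1 * m, k • p.2) = f (k * (p.1 * m), k • p.2)
    rw [mul_assoc]⟩
  one_smul f := by
    ext p
    change f (p.1 * 1, p.2) = f p
    rw [mul_one]
  mul_smul m n f := by
    ext p
    change f (p.1 * (m * n), p.2) = f (p.1 * m * n, p.2)
    rw [mul_assoc]

/-- Post-composition with `h : Y → Z` is an equivariant map of exponents. -/
def expComp (X : Type u) {Y Z : Type u} [MulAction M X] [MulAction M Y] [MulAction M Z]
    (h : Y →[M] Z) : ((M × X) →[M] Y) →[M] ((M × X) →[M] Z) where
  toFun f := h.comp f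
  map_smul' _ _ := rfl

/-- The functor `Y ↦ (X → Y)` on nominal `M`-sets: the exponent object consists of the finitely
supported equivariant maps `M × X → Y`, and a morphism acts by post-composition. -/
def expFunctor (X : NomSet.{u} M) : NomSet.{u} M ⥤ NomSet.{u} M where
  obj Y := nominalPart M ((M × X.carrier) →[M] Y.carrier)
  map {Y Z} h := NomSet.homMk
    (fun f => ⟨expComp X.carrier (show Y.carrier →[M] Z.carrier from h) f.1, by
      obtain ⟨C, hC, hf⟩ := f.2
      exact ⟨C, hC, hf.map _⟩⟩)
    (fun _ _ => rfl)

/-- The functor `B_M`, `B_M X = O × (Σ → X)`, whose coalgebras are the `M`-nominal automata. -/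
def autFunctor (Sig O : NomSet.{u} M) : NomSet.{u} M ⥤ NomSet.{u} M :=
  expFunctor Sig ⋙ prodFunctor O

end Category

/-! ### The free and the forgetful functor -/

section FreeForget

variable {A : Type}

/-- The forgetful functor `U` from nominal `Sb`-sets to nominal `Pm`-sets. -/
def forgetFunctor (A : Type) : NomSet.{u} (Sb A) ⥤ NomSet.{u} (Pm A) where
  obj X :=
    { carrier := X.carrier
      action := MulAction.compHom X.carrier (incl A)
      nominal := fun x => by
        obtain ⟨C, hC, hx⟩ := X.nominal x
        exact ⟨C, hC, fun g h hgh => hx (incl A g) (incl A h) hgh⟩ }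
  map {X Y} f := @NomSet.homMk A (Pm A) _ _ (@NomSet.fn A (Sb A) X Y f) fun g x =>
    @NomSet.fn_smul A (Sb A) X Y f (incl A g) x

/-- The relation generating the equivalence relation on pairs `(m, x)` in the free construction. -/
inductive FreeRel (X : Type u) [MulAction (Pm A) X] : Sb A × X → Sb A × X → Prop
  | perm (m : Sb A) (g : Pm A) (x : X) : FreeRel X (m, g • x) (m * incl A g, x)
  | supp (m m' : Sb A) (x : X) (C : Set A) (hC : C.Finite) (hx : IsSupport (Pm A) C x)
      (h : ∀ a ∈ C, m.1 a = m'.1 a) : FreeRel X (m, x) (m', x)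

/-- The set `F X` of classes `[m, x]`: the quotient of the set of pairs by the least equivalence
relation containing `FreeRel`. -/
def FreeSet (X : Type u) [MulAction (Pm A) X] : Type u := Quot (FreeRel (A := A) X)

/-- The class `[m, x]`. -/
def FreeSet.mk {X : Type u} [MulAction (Pm A) X] (m : Sb A) (x : X) : FreeSet (A := A) X :=
  Quot.mk _ (m, x)

theorem FreeSet.mk_perm {X : Type u} [MulAction (Pm A) X] (m : Sb A) (g : Pm A) (x : X) :
    FreeSet.mk m (g • x) = FreeSet.mk (m * incl A g) x :=
  Quot.sound (FreeRel.perm m g x)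

theorem FreeSet.mk_supp {X : Type u} [MulAction (Pm A) X] {m m' : Sb A} {x : X} {C : Set A}
    (hC : C.Finite) (hx : IsSupport (Pm A) C x) (h : ∀ a ∈ C, m.1 a = m'.1 a) :
    FreeSet.mk m x = FreeSet.mk m' x :=
  Quot.sound (FreeRel.supp m m' x C hC hx h)

/-- The action `n • [m, x] = [n m, x]`. -/
instance (X : Type u) [MulAction (Pm A) X] : MulAction (Sb A) (FreeSet (A := A) X) where
  smul n := Quot.lift (fun p => FreeSet.mk (n * p.1) p.2) (by
    rintro _ _ (⟨m, g, x⟩ | ⟨m, m', x, C, hC, hx, h⟩)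
    · change FreeSet.mk (n * m) (g • x) = FreeSet.mk (n * (m * incl A g)) x
      rw [FreeSet.mk_perm, mul_assoc]
    · exact FreeSet.mk_supp hC hx fun a ha => congrArg n.1 (h a ha))
  one_smul := by
    rintro ⟨m, x⟩
    change FreeSet.mk (1 * m) x = FreeSet.mk m x
    rw [one_mul]
  mul_smul := by
    rintro n n' ⟨m, x⟩
    change FreeSet.mk (n * n' * m) x = FreeSet.mk (n * (n' * m)) x
    rw [mul_assoc]

/-- The free functor `F` from nominal `Pm`-sets to nominal `Sb`-sets, given on morphisms by
`F f [m, x] = [m, f x]`. -/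
def freeFunctor (A : Type) : NomSet.{u} (Pm A) ⥤ NomSet.{u} (Sb A) where
  obj X :=
    { carrier := FreeSet (A := A) X.carrier
      nominal := by
        rintro ⟨m, x⟩
        obtain ⟨C, hC, hx⟩ := X.nominal x
        refine ⟨m.1 '' C, hC.image _, fun m₁ m₂ h => ?_⟩
        exact FreeSet.mk_supp hC hx fun a ha => h _ ⟨a, ha, rfl⟩ }
  map {X Y} f := NomSet.homMk
    (Quot.lift (fun p => FreeSet.mk p.1 (NomSet.fn f p.2)) (by
      rintro _ _ (⟨m, g, x⟩ | ⟨m, m', x, C, hC, hx, h⟩)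
      · change FreeSet.mk m (NomSet.fn f (g • x)) = FreeSet.mk (m * incl A g) (NomSet.fn f x)
        rw [NomSet.fn_smul, FreeSet.mk_perm]
      · exact FreeSet.mk_supp hC (NomSet.isSupport_fn f hx) h))
    (by rintro n ⟨m, x⟩; rfl)
  map_id X := by
    apply NomSet.hom_ext; rintro ⟨m, x⟩; rfl
  map_comp f g := by
    apply NomSet.hom_ext; rintro ⟨m, x⟩; rfl

/-! ### Facts about finite permutations and supports -/

theorem inv_apply_of_fix {g : Pm A} {C : Set A} (h : ∀ a ∈ C, g.1 a = a) :
    ∀ a ∈ C, (g⁻¹).1 a = a := by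
  intro a ha
  have h1 : (g⁻¹).1 (g.1 a) = a := congrFun (congrArg Subtype.val (inv_mul_cancel g)) a
  rwa [h a ha] at h1

theorem inv_apply_self (g : Pm A) (a : A) : (g⁻¹).1 (g.1 a) = a :=
  congrFun (congrArg Subtype.val (inv_mul_cancel g)) a

theorem apply_inv_self (g : Pm A) (a : A) : g.1 ((g⁻¹).1 a) = a :=
  congrFun (congrArg Subtype.val (mul_inv_cancel g)) a

open Classical in
/-- The transposition of two atoms. -/
noncomputable def transp (a b : A) : Pm A :=
  ⟨(Equiv.swap a b : A → A), by
    refine Set.Finite.subset (s := {a, b}) (by simp) ?_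
    intro c hc
    by_contra h
    simp only [Set.mem_insert_iff, Set.mem_singleton_iff, not_or] at h
    exact hc (Equiv.swap_apply_of_ne_of_ne h.1 h.2), (Equiv.swap a b).bijective⟩

/-- A finite injective partial map extends to a finite permutation fixing given other atoms. -/
theorem exists_extend {S : Set A} (hS : S.Finite) (D : Set A) (φ : A → A)
    (hφ : Set.InjOn φ S) (hSD : Disjoint S D) (hφD : Disjoint (φ '' S) D) :
    ∃ h : Pm A, (∀ a ∈ D, h.1 a = a) ∧ ∀ a ∈ S, h.1 a = φ a := by
  classical
  induction S, hS using Set.Finite.induction_on with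
  | empty => exact ⟨1, fun _ _ => rfl, fun a ha => absurd ha (Set.notMem_empty a)⟩
  | @insert s S hs hS ih =>
    obtain ⟨h, h1, h2⟩ := ih (hφ.mono (Set.subset_insert _ _))
      (hSD.mono_left (Set.subset_insert _ _))
      (hφD.mono_left (Set.image_mono (Set.subset_insert _ _)))
    have hinj : Function.Injective h.1 := h.2.2.1
    refine ⟨transp (h.1 s) (φ s) * h, fun a ha => ?_, fun a ha => ?_⟩
    · change Equiv.swap (h.1 s) (φ s) (h.1 a) = a
      rw [h1 a ha]
      apply Equiv.swap_apply_of_ne_of_ne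
      · intro e
        have e2 : h.1 a = h.1 s := (h1 a ha).trans e
        exact Set.disjoint_left.1 hSD (Set.mem_insert s S) (hinj e2 ▸ ha)
      · rintro rfl
        exact Set.disjoint_left.1 hφD ⟨s, Set.mem_insert s S, rfl⟩ ha
    · change Equiv.swap (h.1 s) (φ s) (h.1 a) = φ a
      rcases Set.mem_insert_iff.1 ha with rfl | haS
      · exact Equiv.swap_apply_left _ _
      · have hne : a ≠ s := fun e => hs (e ▸ haS)
        rw [Equiv.swap_apply_of_ne_of_ne (fun e => hne (hinj e)), h2 a haS]
        rw [h2 a haS]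
        exact fun e => hne (hφ ha (Set.mem_insert s S) e)

/-- Finitely many atoms can be moved away from a finite set while fixing given other atoms. -/
theorem exists_fresh [Infinite A] {S C Z : Set A} (hS : S.Finite) (hC : C.Finite) (hZ : Z.Finite)
    (hSC : Disjoint S C) :
    ∃ h : Pm A, (∀ a ∈ C, h.1 a = a) ∧ ∀ a ∈ S, h.1 a ∉ Z := by
  classical
  have hinf : Infinite ((Z ∪ C)ᶜ : Set A) := (hZ.union hC).infinite_compl.to_subtype
  have := hS.to_subtype
  obtain ⟨e, he⟩ := Countable.exists_injective_nat S
  let φ : A → A := fun a => if h : a ∈ S then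
    (Infinite.natEmbedding ((Z ∪ C)ᶜ : Set A) (e ⟨a, h⟩)).1 else a
  have hval : ∀ a (h : a ∈ S), φ a = (Infinite.natEmbedding ((Z ∪ C)ᶜ : Set A) (e ⟨a, h⟩)).1 :=
    fun a h => dif_pos h
  have hmem : ∀ a ∈ S, φ a ∈ (Z ∪ C)ᶜ := fun a h => by
    rw [hval a h]; exact (Infinite.natEmbedding ((Z ∪ C)ᶜ : Set A) (e ⟨a, h⟩)).2
  obtain ⟨h, h1, h2⟩ := exists_extend hS C φ (fun a ha b hb hab => by
      rw [hval a ha, hval b hb] at hab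
      have := he ((Infinite.natEmbedding _).injective (Subtype.ext hab))
      exact congrArg Subtype.val this) hSC (by
      rw [Set.disjoint_left]
      rintro _ ⟨a, ha, rfl⟩ hc
      exact hmem a ha (Or.inr hc))
  exact ⟨h, h1, fun a ha hz => hmem a ha (Or.inl (h2 a ha ▸ hz))⟩

theorem IsSupport.fix {X : Type u} [MulAction (Pm A) X] {C : Set A} {x : X}
    (h : IsSupport (Pm A) C x) {g : Pm A} (hg : ∀ a ∈ C, g.1 a = a) : g • x = x := by
  rw [h g 1 hg, one_smul]

theorem isSupport_of_fix {X : Type u} [MulAction (Pm A) X] {C : Set A} {x : X}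
    (h : ∀ g : Pm A, (∀ a ∈ C, g.1 a = a) → g • x = x) : IsSupport (Pm A) C x := by
  intro g₁ g₂ hg
  have h1 : (g₂⁻¹ * g₁) • x = x := h _ fun a ha => by
    change (g₂⁻¹).1 (g₁.1 a) = a
    rw [hg a ha, inv_apply_self]
  rw [mul_smul] at h1
  exact inv_smul_eq_iff.1 h1

/-- On a nominal `Sb`-set, finite `Pm`-supports are `Sb`-supports. -/
theorem isSupport_Sb_of_Pm [Infinite A] (X : NomSet.{u} (Sb A)) {C : Set A} (hC : C.Finite)
    {x : X.carrier} (h : ∀ g : Pm A, (∀ a ∈ C, g.1 a = a) → incl A g • x = x) :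
    IsSupport (Sb A) C x := by
  classical
  intro m₁ m₂ hm
  obtain ⟨D, hD, hx⟩ := X.nominal x
  obtain ⟨g, g1, g2⟩ := exists_fresh (S := D \ C) (Z := D) (hD.subset Set.sdiff_subset) hC hD
    Set.disjoint_sdiff_left
  have hf : {a : A | (if a ∈ D then m₁.1 a else m₂.1 a) ≠ a}.Finite := by
    refine (Set.Finite.union m₁.2 m₂.2).subset fun a ha => ?_
    by_cases haD : a ∈ D
    · left
      simpa [haD] using ha
    · right
      simpa [haD] using ha
  let m₃ : Sb A := ⟨(fun a => if a ∈ D then m₁.1 a else m₂.1 a : A → A), hf⟩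
  have e1 : m₃ • x = m₁ • x := hx _ _ fun a ha => if_pos ha
  have e2 : (m₃ * incl A g) • x = (m₂ * incl A g) • x := hx _ _ fun a ha => by
    change (if g.1 a ∈ D then m₁.1 (g.1 a) else m₂.1 (g.1 a)) = m₂.1 (g.1 a)
    by_cases haC : a ∈ C
    · rw [g1 a haC, if_pos ha, hm a haC]
    · exact if_neg (g2 a ⟨ha, haC⟩)
  rw [mul_smul, mul_smul, h g g1] at e2
  rw [← e1, e2]

/-- The unit `X ⟶ U F X`, `x ↦ [id, x]`. -/
def unitHom (X : NomSet.{u} (Pm A)) : X ⟶ (forgetFunctor A).obj ((freeFunctor A).obj X) :=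
  NomSet.homMk (fun x => FreeSet.mk 1 x) fun g x => by
    change FreeSet.mk 1 (g • x) = FreeSet.mk (incl A g * 1) x
    rw [FreeSet.mk_perm, one_mul, mul_one]

/-- The counit `F U Y ⟶ Y`, `[m, y] ↦ m • y`. -/
def counitHom [Infinite A] (Y : NomSet.{u} (Sb A)) :
    (freeFunctor A).obj ((forgetFunctor A).obj Y) ⟶ Y :=
  NomSet.homMk
    (Quot.lift (fun p => p.1 • (show Y.carrier from p.2)) (by
      rintro _ _ (⟨m, g, x⟩ | ⟨m, m', x, C, hC, hx, h⟩)
      · exact (mul_smul m (incl A g) (show Y.carrier from x)).symm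
      · exact isSupport_Sb_of_Pm Y hC (fun g hg => hx.fix hg) m m' h))
    (by rintro n ⟨m, x⟩; exact mul_smul n m (show Y.carrier from x))

/-- The adjunction `F ⊣ U` between nominal `Pm`-sets and nominal `Sb`-sets. -/
def freeForgetAdj (A : Type) [Infinite A] : freeFunctor.{u} A ⊣ forgetFunctor.{u} A :=
  Adjunction.mkOfUnitCounit
    { unit :=
        { app := unitHom
          naturality := fun _ _ _ => NomSet.hom_ext fun _ => rfl }
      counit :=
        { app := counitHom
          naturality := fun _ _ f => NomSet.hom_ext (by
            rintro ⟨m, x⟩; exact (NomSet.fn_smul f m x).symm) }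
      left_triangle := by
        ext X
        apply NomSet.hom_ext
        rintro ⟨m, x⟩
        change FreeSet.mk (m * 1) x = FreeSet.mk m x
        rw [mul_one]
      right_triangle := by
        ext Y
        apply NomSet.hom_ext
        intro y
        exact one_smul (Sb A) (show Y.carrier from y) }

end FreeForget

/-! ### Least supports of nominal `Pm`-sets -/

section LeastSupport

variable {A : Type} [Infinite A] {X : Type u} [MulAction (Pm A) X]

theorem IsSupport.inter {C D : Set A} {x : X} (hC : C.Finite) (hD : D.Finite)
    (h₁ : IsSupport (Pm A) C x) (h₂ : IsSupport (Pm A) D x) : IsSupport (Pm A) (C ∩ D) x := by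
  apply isSupport_of_fix
  intro g hg
  obtain ⟨h, k1, k2⟩ := exists_fresh (S := D \ C) (Z := {a | g.1 a ≠ a})
    (hD.subset Set.sdiff_subset) hC g.2.1 Set.disjoint_sdiff_left
  have hx := h₂.smul h
  rw [h₁.fix k1] at hx
  apply hx.fix
  rintro _ ⟨a, ha, rfl⟩
  by_cases haC : a ∈ C
  · rw [k1 a haC]; exact hg a ⟨haC, ha⟩
  · exact not_not.1 (k2 a ⟨ha, haC⟩)

theorem supp_spec {x : X} (hx : HasFiniteSupport (Pm A) x) :
    (supp (Pm A) x).Finite ∧ IsSupport (Pm A) (supp (Pm A) x) x := by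
  obtain ⟨C, ⟨hC, hCx⟩, hmin⟩ := (measure (Set.ncard (α := A))).wf.has_min
    {C : Set A | C.Finite ∧ IsSupport (Pm A) C x} hx
  have hle : ∀ D : Set A, D.Finite → IsSupport (Pm A) D x → C ⊆ D := by
    intro D hD hDx
    have h1 := hmin (C ∩ D) ⟨hC.subset Set.inter_subset_left, hCx.inter hC hD hDx⟩
    have h2 : C ∩ D = C := Set.eq_of_subset_of_ncard_le Set.inter_subset_left (not_lt.1 h1) hC
    exact h2 ▸ Set.inter_subset_right
  have : supp (Pm A) x = C := Set.Subset.antisymm (Set.sInter_subset_of_mem ⟨hC, hCx⟩)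
    (Set.subset_sInter fun D hD => hle D hD.1 hD.2)
  rw [this]
  exact ⟨hC, hCx⟩

theorem supp_subset {A : Type} {X : Type u} [MulAction (Pm A) X] {C : Set A} {x : X}
    (hC : C.Finite) (h : IsSupport (Pm A) C x) :
    supp (Pm A) x ⊆ C := Set.sInter_subset_of_mem ⟨hC, h⟩

theorem supp_smul (g : Pm A) {x : X} (hx : HasFiniteSupport (Pm A) x) :
    supp (Pm A) (g • x) = g.1 '' supp (Pm A) x := by
  have key : ∀ (g : Pm A) (x : X), HasFiniteSupport (Pm A) x →
      supp (Pm A) (g • x) ⊆ g.1 '' supp (Pm A) x := fun g x hx =>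
    supp_subset ((supp_spec hx).1.image _) ((supp_spec hx).2.smul g)
  refine Set.Subset.antisymm (key g x hx) ?_
  rintro _ ⟨a, ha, rfl⟩
  have h := key g⁻¹ (g • x) (hx.smul g)
  rw [inv_smul_smul] at h
  obtain ⟨b, hb, rfl⟩ := h ha
  rwa [apply_inv_self]

theorem separated_iff {Y : Type u} [MulAction (Pm A) Y] {x : X} {y : Y}
    (hx : HasFiniteSupport (Pm A) x) (hy : HasFiniteSupport (Pm A) y) :
    Separated (Pm A) x y ↔ Disjoint (supp (Pm A) x) (supp (Pm A) y) := by
  constructor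
  · rintro ⟨C, D, hC, hD, hCD, h1, h2⟩
    exact hCD.mono (supp_subset hC h1) (supp_subset hD h2)
  · intro h
    exact ⟨_, _, (supp_spec hx).1, (supp_spec hy).1, h, (supp_spec hx).2, (supp_spec hy).2⟩

end LeastSupport

/-! ### The magic wand -/

/-- Partial functions from `X` to `Y`; the value `none` means undefined. -/
@[ext]
structure PartialMap (X Y : Type u) : Type u where
  toFun : X → Option Y

section Wand

variable {A : Type}

/-- The action on partial functions: `(g • f) x = g • f (g⁻¹ • x)`, defined if `f (g⁻¹ • x)` is. -/
noncomputable instance (X Y : Type u) [MulAction (Pm A) X] [MulAction (Pm A) Y] :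
    MulAction (Pm A) (PartialMap X Y) where
  smul g f := ⟨fun x => (f.toFun (g⁻¹ • x)).map fun y => g • y⟩
  one_smul f := by
    ext x : 2
    change (f.toFun ((1 : Pm A)⁻¹ • x)).map (fun y => (1 : Pm A) • y) = f.toFun x
    simp
  mul_smul g h f := by
    ext x : 2
    change (f.toFun ((g * h)⁻¹ • x)).map (fun y => (g * h) • y) =
      ((f.toFun (h⁻¹ • g⁻¹ • x)).map fun y => h • y).map fun y => g • y
    rw [mul_inv_rev, mul_smul, Option.map_map]
    congr 1
    funext y
    exact mul_smul g h y

/-- A partial function `f` is separating if it is finitely supported, `f x` is defined if and only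
if `f` and `x` are separated, and `supp f` is the union of the sets `supp (f x) \ supp x` over all
`x` in the domain of `f`. -/
def IsSeparating (A : Type) {X Y : Type u} [MulAction (Pm A) X] [MulAction (Pm A) Y]
    (f : PartialMap X Y) : Prop :=
  HasFiniteSupport (Pm A) f ∧
  (∀ x : X, (∃ y, f.toFun x = some y) ↔ Separated (Pm A) f x) ∧
  supp (Pm A) f = ⋃ (x : X) (y : Y) (_ : f.toFun x = some y), supp (Pm A) y \ supp (Pm A) x

section

variable {X Y : Type u} [MulAction (Pm A) X] [MulAction (Pm A) Y]

theorem PartialMap.smul_eq_some {g : Pm A} {f : PartialMap X Y} {x : X} {y : Y} :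
    (g • f).toFun x = some y ↔ f.toFun (g⁻¹ • x) = some (g⁻¹ • y) := by
  change (f.toFun (g⁻¹ • x)).map (fun y => g • y) = some y ↔ _
  rw [Option.map_eq_some_iff]
  constructor
  · rintro ⟨z, hz, rfl⟩
    rw [hz, inv_smul_smul]
  · intro h
    exact ⟨_, h, smul_inv_smul g y⟩

theorem PartialMap.ext_some {f f' : PartialMap X Y}
    (h : ∀ x y, f.toFun x = some y ↔ f'.toFun x = some y) : f = f' := by
  ext x y
  exact h x y

theorem PartialMap.apply_smul {g : Pm A} {f : PartialMap X Y} (hf : g • f = f) {x : X} {y : Y}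
    (h : f.toFun x = some y) : f.toFun (g • x) = some (g • y) := by
  rw [← hf, PartialMap.smul_eq_some, inv_smul_smul, inv_smul_smul, h]

variable [Infinite A]

/-- The value of a partial function is supported by supports of the function and the argument. -/
theorem PartialMap.supp_value (hX : ∀ x : X, HasFiniteSupport (Pm A) x)
    {f : PartialMap X Y} {C : Set A} (hC : C.Finite)
    (hf : IsSupport (Pm A) C f) {x : X} {y : Y} (h : f.toFun x = some y) :
    supp (Pm A) y ⊆ C ∪ supp (Pm A) x := by
  apply supp_subset (hC.union (supp_spec (hX x)).1)
  apply isSupport_of_fix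
  intro g hg
  have h1 := PartialMap.apply_smul (hf.fix fun a ha => hg a (Or.inl ha)) h
  rw [(supp_spec (hX x)).2.fix fun a ha => hg a (Or.inr ha), h] at h1
  exact (Option.some.inj h1).symm

theorem IsSeparating.dom_iff (hX : ∀ x : X, HasFiniteSupport (Pm A) x)
    {f : PartialMap X Y} (hf : IsSeparating A f) (x : X) :
    (∃ y, f.toFun x = some y) ↔ Disjoint (supp (Pm A) f) (supp (Pm A) x) :=
  (hf.2.1 x).trans (separated_iff hf.1 (hX x))

theorem IsSeparating.smul (hX : ∀ x : X, HasFiniteSupport (Pm A) x)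
    (hY : ∀ y : Y, HasFiniteSupport (Pm A) y) {f : PartialMap X Y}
    (hf : IsSeparating A f) (g : Pm A) :
    IsSeparating A (g • f) := by
  have hinj : Function.Injective g.1 := g.2.2.1
  refine ⟨hf.1.smul g, fun x => ?_, ?_⟩
  · rw [separated_iff (hf.1.smul g) (hX x), supp_smul g hf.1]
    have hx : supp (Pm A) x = g.1 '' supp (Pm A) (g⁻¹ • x) := by
      rw [← supp_smul g (hX _), smul_inv_smul]
    rw [hx, Set.disjoint_image_iff hinj, ← hf.dom_iff hX]
    constructor
    · rintro ⟨y, hy⟩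
      exact ⟨_, PartialMap.smul_eq_some.1 hy⟩
    · rintro ⟨y, hy⟩
      refine ⟨g • y, PartialMap.smul_eq_some.2 ?_⟩
      rw [inv_smul_smul, hy]
  · rw [supp_smul g hf.1]
    ext a
    simp only [Set.mem_iUnion, exists_prop]
    constructor
    · rintro ⟨b, hb, rfl⟩
      rw [hf.2.2] at hb
      simp only [Set.mem_iUnion, exists_prop] at hb
      obtain ⟨x, y, hxy, hby, hbx⟩ := hb
      refine ⟨g • x, g • y, PartialMap.smul_eq_some.2 (by simpa using hxy), ?_, ?_⟩
      · rw [supp_smul g (hY y)]; exact ⟨b, hby, rfl⟩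
      · rw [supp_smul g (hX x)]
        rintro ⟨c, hc, hcb⟩
        exact hbx (hinj hcb ▸ hc)
    · rintro ⟨x, y, hxy, hay, hax⟩
      refine ⟨(g⁻¹).1 a, ?_, apply_inv_self g a⟩
      rw [hf.2.2]
      simp only [Set.mem_iUnion, exists_prop]
      refine ⟨g⁻¹ • x, g⁻¹ • y, PartialMap.smul_eq_some.1 hxy, ?_, ?_⟩
      · rw [supp_smul g⁻¹ (hY y)]; exact ⟨a, hay, rfl⟩
      · rw [supp_smul g⁻¹ (hX x)]
        rintro ⟨c, hc, hcb⟩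
        have : c = a := (g⁻¹).2.2.1 hcb
        exact hax (this ▸ hc)

/-- Any element can be moved away from a finite set, fixing a set from which it is separated. -/
theorem exists_move (hX : ∀ x : X, HasFiniteSupport (Pm A) x)
    {C D : Set A} (hC : C.Finite) (hD : D.Finite) {x : X}
    (hx : Disjoint C (supp (Pm A) x)) :
    ∃ g : Pm A, (∀ a ∈ C, g.1 a = a) ∧ Disjoint D (supp (Pm A) (g • x)) := by
  obtain ⟨g, h1, h2⟩ := exists_fresh (supp_spec (hX x)).1 hC hD hx.symm
  refine ⟨g, h1, ?_⟩
  rw [supp_smul g (hX x), Set.disjoint_right]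
  rintro _ ⟨a, ha, rfl⟩
  exact h2 a ha

/-- A separating function is determined by its values on the elements away from a finite set. -/
theorem IsSeparating.unique (hX : ∀ x : X, HasFiniteSupport (Pm A) x)
    (hY : ∀ y : Y, HasFiniteSupport (Pm A) y) {f f' : PartialMap X Y}
    (hf : IsSeparating A f) (hf' : IsSeparating A f')
    {D : Set A} (hD : D.Finite)
    (h : ∀ x, Disjoint D (supp (Pm A) x) → ∀ y y', f.toFun x = some y → f'.toFun x = some y' →
      y = y') : f = f' := by
  have hfs := supp_spec hf.1
  have hfs' := supp_spec hf'.1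
  have key : ∀ {f f' : PartialMap X Y}, IsSeparating A f → IsSeparating A f' →
      (∀ x, Disjoint D (supp (Pm A) x) → ∀ y y', f.toFun x = some y → f'.toFun x = some y' →
        y = y') → supp (Pm A) f ⊆ supp (Pm A) f' := by
    intro f f' hf hf' h a ha
    have ha' := ha
    rw [hf.2.2] at ha
    simp only [Set.mem_iUnion, exists_prop] at ha
    obtain ⟨x, y, hxy, hay, hax⟩ := ha
    obtain ⟨g, g1, g2⟩ := exists_move hX (supp_spec hf.1).1
      (hD.union (supp_spec hf'.1).1) ((hf.dom_iff hX x).1 ⟨y, hxy⟩)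
    rw [Set.disjoint_union_left] at g2
    obtain ⟨y', hy'⟩ := (hf'.dom_iff hX (g • x)).2 g2.2
    have hgy := PartialMap.apply_smul ((supp_spec hf.1).2.fix g1) hxy
    have e := h _ g2.1 _ _ hgy hy'
    rw [← e] at hy'
    rw [hf'.2.2]
    simp only [Set.mem_iUnion, exists_prop]
    refine ⟨_, _, hy', ?_, ?_⟩
    · rw [supp_smul g (hY y)]; exact ⟨a, hay, g1 a ha'⟩
    · rw [supp_smul g (hX x)]
      rintro ⟨b, hb, hba⟩
      have : b = a := g.2.2.1 (hba.trans (g1 a ha').symm)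
      exact hax (this ▸ hb)
  have hs : supp (Pm A) f = supp (Pm A) f' := Set.Subset.antisymm (key hf hf' h)
    (key hf' hf fun x hx y y' hy hy' => (h x hx y' y hy' hy).symm)
  have half : ∀ {f f' : PartialMap X Y}, IsSeparating A f → IsSeparating A f' →
      supp (Pm A) f = supp (Pm A) f' →
      (∀ x, Disjoint D (supp (Pm A) x) → ∀ y y', f.toFun x = some y → f'.toFun x = some y' →
        y = y') → ∀ x y, f.toFun x = some y → f'.toFun x = some y := by
    intro f f' hf hf' hs h x y hxy
    have hx := (hf.dom_iff hX x).1 ⟨y, hxy⟩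
    obtain ⟨y', hy'⟩ := (hf'.dom_iff hX x).2 (hs ▸ hx)
    obtain ⟨g, g1, g2⟩ := exists_move hX (supp_spec hf.1).1 hD hx
    have e := h _ g2 _ _ (PartialMap.apply_smul ((supp_spec hf.1).2.fix g1) hxy)
      (PartialMap.apply_smul ((supp_spec hf'.1).2.fix (hs ▸ g1)) hy')
    rw [MulAction.injective g e]
    exact hy'
  exact PartialMap.ext_some fun x y => ⟨half hf hf' hs h x y,
    half hf' hf hs.symm (fun x hx y y' hy hy' => (h x hx y' y hy' hy).symm) x y⟩

/-- A partial function whose domain consists of the elements separated from some finite support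
extends to a separating function. -/
theorem exists_isSeparating_extension (hX : ∀ x : X, HasFiniteSupport (Pm A) x)
    (hY : ∀ y : Y, HasFiniteSupport (Pm A) y) (p : PartialMap X Y) {D : Set A} (hD : D.Finite)
    (hp : IsSupport (Pm A) D p)
    (hdom : ∀ x, (∃ y, p.toFun x = some y) ↔ Disjoint D (supp (Pm A) x)) :
    ∃ q : PartialMap X Y, IsSeparating A q ∧ ∀ x y, p.toFun x = some y → q.toFun x = some y := by
  classical
  let C : Set A := {a | ∃ x y, p.toFun x = some y ∧ a ∈ supp (Pm A) y \ supp (Pm A) x}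
  have hCD : C ⊆ D := by
    rintro a ⟨x, y, hxy, hay, hax⟩
    exact (PartialMap.supp_value hX hD hp hxy hay).resolve_right hax
  have hC : C.Finite := hD.subset hCD
  have claim : ∀ (k : Pm A), (∀ a ∈ C, k.1 a = a) → ∀ z w, p.toFun z = some w →
      Disjoint D (supp (Pm A) (k • z)) → p.toFun (k • z) = some (k • w) := by
    intro k hk z w hzw hkz
    have hz := (hdom z).1 ⟨w, hzw⟩
    rw [supp_smul k (hX z)] at hkz
    obtain ⟨k', h1, h2⟩ := exists_extend (supp_spec (hX z)).1 D k.1 (k.2.2.1.injOn) hz.symm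
      hkz.symm
    have e := PartialMap.apply_smul (hp.fix h1) hzw
    rw [(supp_spec (hX z)).2 k' k h2] at e
    rw [e, (supp_spec (hY w)).2 k' k]
    intro a ha
    by_cases haz : a ∈ supp (Pm A) z
    · exact h2 a haz
    · have haC : a ∈ C := ⟨z, w, hzw, ha, haz⟩
      rw [hk a haC, h1 a (hCD haC)]
  let R : X → Y → Prop := fun x y =>
    ∃ k : Pm A, (∀ a ∈ C, k.1 a = a) ∧ p.toFun (k • x) = some (k • y)
  have hR : ∀ x y y', R x y → R x y' → y = y' := by
    rintro x y y' ⟨k, hk, e⟩ ⟨k', hk', e'⟩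
    have h := claim (k' * k⁻¹) (fun a ha => by
      change k'.1 ((k⁻¹).1 a) = a
      rw [inv_apply_of_fix hk a ha, hk' a ha]) _ _ e (by
      rw [mul_smul, inv_smul_smul]; exact (hdom _).1 ⟨_, e'⟩)
    rw [mul_smul, mul_smul, inv_smul_smul, inv_smul_smul, e'] at h
    exact (MulAction.injective k' (Option.some.inj h)).symm
  let q : PartialMap X Y := ⟨fun x => if h : ∃ y, R x y then some h.choose else none⟩
  have hq : ∀ x y, q.toFun x = some y ↔ R x y := by
    intro x y
    by_cases h : ∃ y, R x y
    · have e : q.toFun x = some h.choose := dif_pos h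
      rw [e]
      constructor
      · intro e; rw [← Option.some.inj e]; exact h.choose_spec
      · intro hy; rw [hR x _ _ h.choose_spec hy]
    · have e : q.toFun x = none := dif_neg h
      rw [e]
      constructor
      · intro e; cases e
      · intro hy; exact absurd ⟨y, hy⟩ h
  have hpq : ∀ x y, p.toFun x = some y → q.toFun x = some y := fun x y hxy =>
    (hq x y).2 ⟨1, fun _ _ => rfl, by rw [one_smul, one_smul, hxy]⟩
  have hqC : IsSupport (Pm A) C q := by
    apply isSupport_of_fix
    have step : ∀ g : Pm A, (∀ a ∈ C, g.1 a = a) → ∀ x y, R x y → R (g⁻¹ • x) (g⁻¹ • y) := by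
      rintro g hg x y ⟨k, hk, e⟩
      refine ⟨k * g, fun a ha => ?_, ?_⟩
      · change k.1 (g.1 a) = a
        rw [hg a ha, hk a ha]
      · rw [mul_smul, mul_smul, smul_inv_smul, smul_inv_smul, e]
    intro g hg
    apply PartialMap.ext_some
    intro x y
    rw [PartialMap.smul_eq_some, hq, hq]
    constructor
    · intro h
      have := step g⁻¹ (inv_apply_of_fix hg) _ _ h
      rwa [inv_inv, smul_inv_smul, smul_inv_smul] at this
    · exact step g hg x y
  have hun : (⋃ (x : X) (y : Y) (_ : q.toFun x = some y), supp (Pm A) y \ supp (Pm A) x) = C := by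
    ext a
    simp only [Set.mem_iUnion, exists_prop]
    constructor
    · rintro ⟨x, y, hxy, hay, hax⟩
      obtain ⟨k, hk, e⟩ := (hq x y).1 hxy
      have h : k.1 a ∈ C := by
        refine ⟨_, _, e, ?_, ?_⟩
        · rw [supp_smul k (hY y)]; exact ⟨a, hay, rfl⟩
        · rw [supp_smul k (hX x)]
          rintro ⟨b, hb, hba⟩
          have : b = a := k.2.2.1 hba
          exact hax (this ▸ hb)
      have h' : k.1 a = a := k.2.2.1 (hk _ h)
      rwa [h'] at h
    · rintro ⟨x, y, hxy, ha⟩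
      exact ⟨x, y, hpq x y hxy, ha⟩
  have hfs : HasFiniteSupport (Pm A) q := ⟨C, hC, hqC⟩
  have hsupp : supp (Pm A) q = C := by
    refine Set.Subset.antisymm (supp_subset hC hqC) ?_
    rintro a ⟨x, y, hxy, hay, hax⟩
    exact (PartialMap.supp_value hX (supp_spec hfs).1 (supp_spec hfs).2 (hpq x y hxy)
      hay).resolve_right hax
  refine ⟨q, ⟨hfs, fun x => ?_, hsupp.trans hun.symm⟩, hpq⟩
  rw [separated_iff hfs (hX x), hsupp]
  constructor
  · rintro ⟨y, hxy⟩
    obtain ⟨k, hk, e⟩ := (hq x y).1 hxy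
    have h := (hdom _).1 ⟨_, e⟩
    rw [supp_smul k (hX x)] at h
    rw [Set.disjoint_left]
    intro a haC hax
    exact Set.disjoint_left.1 h (hCD haC) ⟨a, hax, hk a haC⟩
  · intro hx
    obtain ⟨k, hk, hkx⟩ := exists_move hX hC hD hx
    obtain ⟨w, hw⟩ := (hdom _).2 hkx
    refine ⟨k⁻¹ • w, (hq _ _).2 ⟨k, hk, ?_⟩⟩
    rw [smul_inv_smul, hw]

end

variable [Infinite A]

/-- The action on separating functions, restricted from the action on partial functions. -/
noncomputable instance wandAction (X Y : NomSet.{u} (Pm A)) :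
    MulAction (Pm A) {f : PartialMap X.carrier Y.carrier // IsSeparating A f} where
  smul g f := ⟨g • f.1, f.2.smul X.nominal Y.nominal g⟩
  one_smul f := Subtype.ext (one_smul (Pm A) f.1)
  mul_smul g h f := Subtype.ext (mul_smul g h f.1)

/-- The nominal `Pm`-set of separating functions from `X` to `Y` (the magic wand). -/
noncomputable def wand (X Y : NomSet.{u} (Pm A)) : NomSet.{u} (Pm A) where
  carrier := {f : PartialMap X.carrier Y.carrier // IsSeparating A f}
  nominal f := by
    obtain ⟨C, hC, hf⟩ := f.2.1
    exact ⟨C, hC, fun g h hgh => Subtype.ext (hf g h hgh)⟩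

theorem wandMap_exists (X : NomSet.{u} (Pm A)) {Y Z : NomSet.{u} (Pm A)} (h : Y ⟶ Z)
    (f : PartialMap X.carrier Y.carrier) (hf : IsSeparating A f) :
    ∃ q : PartialMap X.carrier Z.carrier, IsSeparating A q ∧
      ∀ x y, f.toFun x = some y → q.toFun x = some (NomSet.fn h y) := by
  obtain ⟨q, hq, hq'⟩ := exists_isSeparating_extension X.nominal Z.nominal
    (⟨fun x => (f.toFun x).map (NomSet.fn h)⟩ : PartialMap X.carrier Z.carrier)
    (supp_spec hf.1).1 (isSupport_of_fix fun g hg => PartialMap.ext_some fun x z => by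
      have hfg := (supp_spec hf.1).2.fix hg
      rw [PartialMap.smul_eq_some]
      simp only [Option.map_eq_some_iff]
      constructor
      · rintro ⟨y, hy, e⟩
        refine ⟨g • y, ?_, ?_⟩
        · have := PartialMap.apply_smul hfg hy
          rwa [smul_inv_smul] at this
        · rw [NomSet.fn_smul, e, smul_inv_smul]
      · rintro ⟨y, hy, e⟩
        refine ⟨g⁻¹ • y, ?_, ?_⟩
        · exact PartialMap.apply_smul (inv_smul_eq_iff.2 hfg.symm) hy
        · rw [NomSet.fn_smul, e])
    (fun x => by
      rw [← hf.dom_iff X.nominal x]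
      constructor
      · rintro ⟨z, hz⟩
        obtain ⟨y, hy, -⟩ := Option.map_eq_some_iff.1 hz
        exact ⟨y, hy⟩
      · rintro ⟨y, hy⟩
        exact ⟨_, Option.map_eq_some_iff.2 ⟨y, hy, rfl⟩⟩)
  exact ⟨q, hq, fun x y hxy => hq' x _ (Option.map_eq_some_iff.2 ⟨y, hxy, rfl⟩)⟩

/-- For an equivariant `h : Y ⟶ Z` and a separating `f` from `X` to `Y`, the separating function
from `X` to `Z` that extends `h ∘ f`; it is unique by `IsSeparating.unique`. (The least support of
`h ∘ f` can be smaller than that of `f`, hence `h ∘ f` itself need not be separating.) This is the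
transpose of `h ∘ ev`, where `ev (f, x) = f x` for separated `f` and `x`. -/
noncomputable def wandMap (X : NomSet.{u} (Pm A)) {Y Z : NomSet.{u} (Pm A)} (h : Y ⟶ Z)
    (f : (wand X Y).carrier) : (wand X Z).carrier :=
  ⟨(wandMap_exists X h f.1 f.2).choose, (wandMap_exists X h f.1 f.2).choose_spec.1⟩

theorem wandMap_apply (X : NomSet.{u} (Pm A)) {Y Z : NomSet.{u} (Pm A)} (h : Y ⟶ Z)
    (f : (wand X Y).carrier) {x : X.carrier} {y : Y.carrier} (hxy : f.1.toFun x = some y) :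
    (wandMap X h f).1.toFun x = some (NomSet.fn h y) :=
  (wandMap_exists X h f.1 f.2).choose_spec.2 x y hxy

theorem wandMap_unique (X : NomSet.{u} (Pm A)) {Y Z : NomSet.{u} (Pm A)} (h : Y ⟶ Z)
    (f : (wand X Y).carrier) (q : (wand X Z).carrier)
    (hq : ∀ x y, f.1.toFun x = some y → q.1.toFun x = some (NomSet.fn h y)) :
    wandMap X h f = q := by
  refine Subtype.ext (IsSeparating.unique X.nominal Z.nominal (wandMap X h f).2 q.2
    (supp_spec f.2.1).1 fun x hx z z' hz hz' => ?_)
  obtain ⟨y, hy⟩ := (f.2.dom_iff X.nominal x).2 hx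
  rw [wandMap_apply X h f hy] at hz
  rw [hq x y hy] at hz'
  exact (Option.some.inj hz).symm.trans (Option.some.inj hz')

/-- The magic wand as a functor in its second argument. -/
noncomputable def wandFunctor (X : NomSet.{u} (Pm A)) : NomSet.{u} (Pm A) ⥤ NomSet.{u} (Pm A) where
  obj Y := wand X Y
  map h := NomSet.homMk (wandMap X h) fun g f => by
    apply wandMap_unique
    intro x y hxy
    have hxy' := PartialMap.smul_eq_some.1 (show (g • f.1).toFun x = some y from hxy)
    have e := wandMap_apply X h f hxy'
    rw [NomSet.fn_smul] at e
    exact PartialMap.smul_eq_some.2 e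
  map_id Y := NomSet.hom_ext fun f => wandMap_unique X _ f f fun _ _ hxy => hxy
  map_comp h k := NomSet.hom_ext fun f => wandMap_unique X _ f _ fun _ _ hxy =>
    wandMap_apply X k _ (wandMap_apply X h f hxy)

/-- The functor `S`, `S X = O × (Σ -∗ X)`, whose coalgebras are the separated automata. -/
noncomputable def sepFunctor (Sig O : NomSet.{u} (Pm A)) :
    NomSet.{u} (Pm A) ⥤ NomSet.{u} (Pm A) :=
  wandFunctor Sig ⋙ prodFunctor O

end Wand

end Nominal

/-! The theorem splits into a formal half and a nominal half.

Formal half: let `F ⊣ U` and let `θ : B ⋙ U ≅ U ⋙ S`. A `B`-coalgebra `d` becomes an `S`-coalgebra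
by composing `U d` with `θ.hom`. An `S`-coalgebra `c` becomes a `B`-coalgebra on `F X` by
transposing `c ≫ S η ≫ θ.inv`. The old unit and counit are coalgebra morphisms because the two
directions of `θ` cancel (`unit_leftStr`, `leftStr_counit`), and the triangle identities are
inherited.

Nominal half: `U (F Σ → Y) ≅ Σ -∗ U Y`, naturally in `Y`. An `f` in the exponent with support `D` is
determined by its values at `(id, [id, x])` for fresh `x`: after renaming `x` away from `D`, some
`k` agrees with `m` on `D` and with `n` on the support of `x`, and then `f (m, [n, x]) = k • f (id,
[id, x])` (`FreeExp.apply_mk`). These values on fresh `x` extend to exactly one separating function.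
Conversely, the same formula turns a separating `q` into an equivariant map; independence of the
choices is `InducedRel.unique`.

`Represents` relates the two sides. It is a bijective correspondence (`Represents.unique`,
`Represents.injective` and the two existence lemmas), compatible with permutations and with
post-composition, so the isomorphism and its naturality follow. -/

namespace CategoryTheory.Endofunctor.Coalgebra

/-! ### Lifting an adjunction to coalgebras -/

variable {C D : Type*} [Category* C] [Category* D] {F : C ⥤ D} {U : D ⥤ C}
  {S : C ⥤ C} {B : D ⥤ D}

/-- A natural transformation `B ⋙ U ⟶ U ⋙ S` lifts `U` to coalgebras. -/
def liftRight (θ : B ⋙ U ⟶ U ⋙ S) : Coalgebra B ⥤ Coalgebra S where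
  obj d := { V := U.obj d.V, str := U.map d.str ≫ θ.app d.V }
  map {d e} f :=
    { f := U.map f.f
      h := by
        have h := θ.naturality f.f
        simp only [Functor.comp_map] at h
        rw [Category.assoc, ← h, ← U.map_comp_assoc, f.h, U.map_comp, Category.assoc] }

variable (adj : F ⊣ U)

/-- The unit of an adjunction with its type in unfolded form. -/
abbrev unitAt (X : C) : X ⟶ U.obj (F.obj X) := adj.unit.app X

theorem unitAt_naturality {X Y : C} (f : X ⟶ Y) :
    unitAt adj X ≫ U.map (F.map f) = f ≫ unitAt adj Y :=
  adj.unit_naturality f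

theorem unitAt_counit (Y : D) : unitAt adj (U.obj Y) ≫ U.map (adj.counit.app Y) = 𝟙 (U.obj Y) :=
  adj.right_triangle_components Y

/-- The structure map on `F X` obtained from a coalgebra on `X` by transposition. -/
def leftStr (θ : U ⋙ S ⟶ B ⋙ U) {X : C} (c : X ⟶ S.obj X) : F.obj X ⟶ B.obj (F.obj X) :=
  (adj.homEquiv _ _).symm (c ≫ S.map (unitAt adj X) ≫ θ.app (F.obj X))

theorem homEquiv_leftStr (θ : U ⋙ S ⟶ B ⋙ U) {X : C} (c : X ⟶ S.obj X) :
    adj.homEquiv _ _ (leftStr adj θ c) = c ≫ S.map (unitAt adj X) ≫ θ.app (F.obj X) :=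
  (adj.homEquiv _ _).apply_symm_apply _

/-- Makes `F f` a coalgebra morphism. After transposing, it reduces to naturality of `θ` and of the
unit; `θ` need not be invertible. -/
theorem leftStr_naturality (θ : U ⋙ S ⟶ B ⋙ U) {X Y : C} {c : X ⟶ S.obj X} {d : Y ⟶ S.obj Y}
    {f : X ⟶ Y} (hf : c ≫ S.map f = f ≫ d) :
    leftStr adj θ c ≫ B.map (F.map f) = F.map f ≫ leftStr adj θ d := by
  apply (adj.homEquiv _ _).injective
  have h : S.map (U.map (F.map f)) ≫ θ.app (F.obj Y) =
    θ.app (F.obj X) ≫ U.map (B.map (F.map f)) := θ.naturality (F.map f)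
  have h' := congrArg S.map (unitAt_naturality adj f)
  rw [S.map_comp, S.map_comp] at h'
  rw [adj.homEquiv_naturality_right, adj.homEquiv_naturality_left, homEquiv_leftStr,
    homEquiv_leftStr, ← Category.assoc f, ← hf]
  calc (c ≫ S.map (unitAt adj X) ≫ θ.app (F.obj X)) ≫ U.map (B.map (F.map f))
      = c ≫ S.map (unitAt adj X) ≫ θ.app (F.obj X) ≫ U.map (B.map (F.map f)) := by
        simp only [Category.assoc]
    _ = c ≫ (S.map (unitAt adj X) ≫ S.map (U.map (F.map f))) ≫ θ.app (F.obj Y) := by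
        rw [← h, Category.assoc]
    _ = _ := by rw [h']; simp only [Category.assoc]

/-- Makes the counit a coalgebra morphism. Both sides transpose to `U.map d`, by a triangle identity
and, on the left, the cancellation of `θ.hom` against `θ.inv`. -/
theorem leftStr_counit (θ : B ⋙ U ≅ U ⋙ S) {Y : D} (d : Y ⟶ B.obj Y) :
    leftStr adj θ.inv (U.map d ≫ θ.hom.app Y) ≫ B.map (adj.counit.app Y) =
      adj.counit.app Y ≫ d := by
  apply (adj.homEquiv _ _).injective
  have h : S.map (U.map (adj.counit.app Y)) ≫ θ.inv.app Y =
      θ.inv.app (F.obj (U.obj Y)) ≫ U.map (B.map (adj.counit.app Y)) :=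
    θ.inv.naturality (adj.counit.app Y)
  have h' := congrArg S.map (unitAt_counit adj Y)
  rw [S.map_comp, S.map_id] at h'
  have h₂ : θ.hom.app Y ≫ θ.inv.app Y = 𝟙 (U.obj (B.obj Y)) := θ.hom_inv_id_app Y
  rw [adj.homEquiv_naturality_right, homEquiv_leftStr, adj.homEquiv_naturality_right]
  calc ((U.map d ≫ θ.hom.app Y) ≫ S.map (unitAt adj (U.obj Y)) ≫ θ.inv.app (F.obj (U.obj Y))) ≫
        U.map (B.map (adj.counit.app Y))
      = U.map d ≫ θ.hom.app Y ≫ S.map (unitAt adj (U.obj Y)) ≫ θ.inv.app (F.obj (U.obj Y)) ≫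
        U.map (B.map (adj.counit.app Y)) := by simp only [Category.assoc]
    _ = U.map d ≫ θ.hom.app Y ≫ (S.map (unitAt adj (U.obj Y)) ≫
        S.map (U.map (adj.counit.app Y))) ≫ θ.inv.app Y := by rw [← h, Category.assoc]
    _ = U.map d ≫ θ.hom.app Y ≫ θ.inv.app Y := by
        rw [h']; exact congrArg (U.map d ≫ θ.hom.app Y ≫ ·) (Category.id_comp _)
    _ = U.map d := by rw [h₂, Category.comp_id]
    _ = unitAt adj (U.obj Y) ≫ U.map (adj.counit.app Y) ≫ U.map d := by
        rw [← Category.assoc, unitAt_counit, Category.id_comp]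
    _ = _ := by rw [adj.homEquiv_unit, Category.assoc]

/-- Makes the unit a coalgebra morphism: the transpose of `leftStr` ends in `θ.inv`, which `θ.hom`
cancels. -/
theorem unit_leftStr (θ : B ⋙ U ≅ U ⋙ S) {X : C} (c : X ⟶ S.obj X) :
    c ≫ S.map (unitAt adj X) =
      unitAt adj X ≫ U.map (leftStr adj θ.inv c) ≫ θ.hom.app (F.obj X) := by
  have h : θ.inv.app (F.obj X) ≫ θ.hom.app (F.obj X) = 𝟙 (S.obj (U.obj (F.obj X))) :=
    θ.inv_hom_id_app (F.obj X)
  have h' : unitAt adj X ≫ U.map (leftStr adj θ.inv c) =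
      c ≫ S.map (unitAt adj X) ≫ θ.inv.app (F.obj X) :=
    (adj.homEquiv_unit _ _ _).symm.trans (homEquiv_leftStr adj θ.inv c)
  calc c ≫ S.map (unitAt adj X)
      = c ≫ S.map (unitAt adj X) ≫ θ.inv.app (F.obj X) ≫ θ.hom.app (F.obj X) := by
        rw [h, Category.comp_id]
    _ = (unitAt adj X ≫ U.map (leftStr adj θ.inv c)) ≫ θ.hom.app (F.obj X) := by
        rw [h']; simp only [Category.assoc]
    _ = _ := Category.assoc _ _ _

/-- A natural transformation `U ⋙ S ⟶ B ⋙ U` lifts the left adjoint of `U` to coalgebras. -/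
def liftLeft (θ : U ⋙ S ⟶ B ⋙ U) : Coalgebra S ⥤ Coalgebra B where
  obj c := { V := F.obj c.V, str := leftStr adj θ c.str }
  map f := { f := F.map f.f, h := leftStr_naturality adj θ f.h }
  map_id c := Coalgebra.ext (F.map_id c.V)
  map_comp f g := Coalgebra.ext (F.map_comp f.f g.f)

/-- An adjunction lifts to coalgebras along a natural isomorphism `B ⋙ U ≅ U ⋙ S`. -/
def liftAdj (θ : B ⋙ U ≅ U ⋙ S) : liftLeft adj θ.inv ⊣ liftRight θ.hom :=
  Adjunction.mkOfUnitCounit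
    { unit :=
        { app := fun c => { f := adj.unit.app c.V, h := unit_leftStr adj θ c.str }
          naturality := fun _ _ f => Coalgebra.ext (adj.unit.naturality f.f) }
      counit :=
        { app := fun d => { f := adj.counit.app d.V, h := leftStr_counit adj θ d.str }
          naturality := fun _ _ f => Coalgebra.ext (adj.counit.naturality f.f) }
      -- The `id_comp` removes the component of the associator, which is an identity; the rest is
      -- the triangle of `adj`.
      left_triangle := NatTrans.ext (funext fun c => Coalgebra.ext
        ((congrArg (F.map (adj.unit.app c.V) ≫ ·) (Category.id_comp _)).trans
          (adj.left_triangle_components c.V)))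
      right_triangle := NatTrans.ext (funext fun d => Coalgebra.ext
        ((congrArg (adj.unit.app (U.obj d.V) ≫ ·) (Category.id_comp _)).trans
          (adj.right_triangle_components d.V))) }

theorem exists_lift_adjunction (θ : B ⋙ U ≅ U ⋙ S) :
    ∃ (Fbar : Coalgebra S ⥤ Coalgebra B) (Ubar : Coalgebra B ⥤ Coalgebra S) (adj' : Fbar ⊣ Ubar),
      Fbar ⋙ forget _ = forget _ ⋙ F ∧ Ubar ⋙ forget _ = forget _ ⋙ U ∧
      (∀ c, (adj'.unit.app c).f ≍ adj.unit.app c.V) ∧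
      (∀ d, (adj'.counit.app d).f ≍ adj.counit.app d.V) :=
  ⟨liftLeft adj θ.inv, liftRight θ.hom, liftAdj adj θ, rfl, rfl,
    fun _ => HEq.rfl, fun _ => HEq.rfl⟩

end CategoryTheory.Endofunctor.Coalgebra

namespace Nominal

/-! ### Elements of the exponent and the separating functions they represent -/

section WandExponent

variable {A : Type}

open Classical in
/-- The substitution that is `m` on `P` and `n` elsewhere. -/
noncomputable def glue (P : Set A) (m n : Sb A) : Sb A :=
  ⟨(fun a => if a ∈ P then m.1 a else n.1 a : A → A), by
    refine (Set.Finite.union m.2 n.2).subset fun a ha => ?_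
    by_cases h : a ∈ P
    · left; simpa [h] using ha
    · right; simpa [h] using ha⟩

theorem glue_of_mem {P : Set A} (m n : Sb A) {a : A} (h : a ∈ P) : (glue P m n).1 a = m.1 a :=
  if_pos h

theorem glue_of_notMem {P : Set A} (m n : Sb A) {a : A} (h : a ∉ P) :
    (glue P m n).1 a = n.1 a :=
  if_neg h

theorem FreeSet.mk_inv_smul {Sig : NomSet.{u} (Pm A)} (n : Sb A) (h : Pm A) (x : Sig.carrier) :
    FreeSet.mk (n * incl A h⁻¹) (h • x) = FreeSet.mk n x := by
  rw [← FreeSet.mk_perm, inv_smul_smul]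

variable [Infinite A]

/-- Supports of values of separating functions are computed for permutations only; this lets them
control the action of substitutions. -/
theorem smul_eq_of_isSupport_Pm (Y : NomSet.{u} (Sb A)) {C : Set A} (hC : C.Finite)
    {y : ((forgetFunctor A).obj Y).carrier} (h : IsSupport (Pm A) C y) {k l : Sb A}
    (hkl : ∀ a ∈ C, k.1 a = l.1 a) :
    k • (show Y.carrier from y) = l • (show Y.carrier from y) :=
  isSupport_Sb_of_Pm Y hC (fun _ hg => h.fix hg) k l hkl

variable (Sig : NomSet.{u} (Pm A)) (Y : NomSet.{u} (Sb A))

/-- The carrier of the exponent of `Y` by the free nominal `Sb`-set on `Sig`. -/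
abbrev FreeExp : Type u :=
  {f : (Sb A × FreeSet (A := A) Sig.carrier) →[Sb A] Y.carrier // HasFiniteSupport (Sb A) f}

variable {Sig Y}

/-- The separating function `q` agrees with `x ↦ f (id, [id, x])` on all sufficiently fresh `x`. -/
def Represents (f : FreeExp Sig Y) (q : (wand Sig ((forgetFunctor A).obj Y)).carrier) : Prop :=
  ∃ D : Set A, D.Finite ∧ ∀ x, Disjoint D (supp (Pm A) x) →
    q.1.toFun x = some (f.1 (1, FreeSet.mk 1 x))

theorem Represents.unique {f : FreeExp Sig Y}
    {q q' : (wand Sig ((forgetFunctor A).obj Y)).carrier}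
    (h : Represents f q) (h' : Represents f q') : q = q' := by
  obtain ⟨D, hD, h⟩ := h
  obtain ⟨D', hD', h'⟩ := h'
  refine Subtype.ext (IsSeparating.unique Sig.nominal ((forgetFunctor A).obj Y).nominal q.2 q'.2
    (hD.union hD') fun x hx y y' hy hy' => ?_)
  rw [Set.disjoint_union_left] at hx
  rw [h x hx.1] at hy
  rw [h' x hx.2] at hy'
  exact Option.some.inj (hy.symm.trans hy')

/-- The support of `f` allows replacing `m` by `k`, the support of `x` allows replacing `n` by `k`,
and equivariance then pulls `k` out. -/
theorem FreeExp.apply_mk {f : FreeExp Sig Y} {D : Set A} (hf : IsSupport (Sb A) D f.1)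
    {m n k : Sb A} {x : Sig.carrier} (hm : ∀ a ∈ D, k.1 a = m.1 a)
    (hn : ∀ a ∈ supp (Pm A) x, k.1 a = n.1 a) :
    f.1 (m, FreeSet.mk n x) = k • f.1 (1, FreeSet.mk 1 x) := by
  have h := DFunLike.congr_fun (hf k m hm) (1, FreeSet.mk n x)
  change f.1 (1 * k, FreeSet.mk n x) = f.1 (1 * m, FreeSet.mk n x) at h
  rw [one_mul, one_mul] at h
  have hx := supp_spec (Sig.nominal x)
  rw [← h, ← FreeSet.mk_supp hx.1 hx.2 hn, ← map_smul]
  change f.1 (k, FreeSet.mk k x) = f.1 (k * 1, FreeSet.mk (k * 1) x)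
  rw [mul_one]

/-- By `FreeExp.apply_mk`, the values on fresh elements determine every value, once `x` has been
renamed to be fresh. -/
theorem Represents.injective {f f' : FreeExp Sig Y}
    {q : (wand Sig ((forgetFunctor A).obj Y)).carrier}
    (h : Represents f q) (h' : Represents f' q) : f = f' := by
  obtain ⟨D, hD, h⟩ := h
  obtain ⟨D', hD', h'⟩ := h'
  obtain ⟨C, hC, hf⟩ := f.2
  obtain ⟨C', hC', hf'⟩ := f'.2
  refine Subtype.ext (MulActionHom.ext ?_)
  rintro ⟨m, ⟨n, x⟩⟩
  change f.1 (m, FreeSet.mk n x) = f'.1 (m, FreeSet.mk n x)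
  -- No atom has to stay fixed, so any `x` can be moved away from all four sets; `[n, x] = [n g⁻¹, g
  -- x]` compensates for the move.
  obtain ⟨g, -, hg⟩ := exists_move Sig.nominal (C := ∅) Set.finite_empty
    ((hD.union hD').union (hC.union hC')) (x := x) (Set.empty_disjoint _)
  rw [Set.disjoint_union_left] at hg
  have hd := Set.disjoint_union_left.1 hg.1
  rw [← FreeSet.mk_inv_smul n g x]
  have hk : ∀ a ∈ supp (Pm A) (g • x),
      (glue (C ∪ C') m (n * incl A g⁻¹)).1 a = (n * incl A g⁻¹).1 a := fun a ha =>
    glue_of_notMem _ _ (Set.disjoint_right.1 hg.2 ha)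
  rw [FreeExp.apply_mk hf (fun a ha => glue_of_mem _ _ (Or.inl ha)) hk,
    FreeExp.apply_mk hf' (fun a ha => glue_of_mem _ _ (Or.inr ha)) hk]
  have e := (h _ hd.1).symm.trans (h' _ hd.2)
  rw [Option.some.inj e]

theorem exists_represents_right (f : FreeExp Sig Y) :
    ∃ q : (wand Sig ((forgetFunctor A).obj Y)).carrier, Represents f q := by
  classical
  obtain ⟨D, hD, hf⟩ := f.2
  -- `D` may exceed the least support that a separating function requires, so `p` itself need not be
  -- separating; its extension is.
  let p : PartialMap Sig.carrier ((forgetFunctor A).obj Y).carrier :=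
    ⟨fun x => if Disjoint D (supp (Pm A) x) then some (f.1 (1, FreeSet.mk 1 x)) else none⟩
  have hp : ∀ x y, p.toFun x = some y ↔
      Disjoint D (supp (Pm A) x) ∧ f.1 (1, FreeSet.mk 1 x) = y := by
    intro x y
    change (if Disjoint D (supp (Pm A) x) then some (f.1 (1, FreeSet.mk 1 x)) else none) =
      some y ↔ _
    by_cases h : Disjoint D (supp (Pm A) x)
    · rw [if_pos h, and_iff_right h]; exact Option.some_inj
    · simp [h]
  have hfix : ∀ (g : Pm A) x, (∀ a ∈ D, g.1 a = a) →
      f.1 (1, FreeSet.mk 1 (g • x)) = incl A g • f.1 (1, FreeSet.mk 1 x) := by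
    intro g x hg
    rw [FreeSet.mk_perm, one_mul]
    exact FreeExp.apply_mk hf hg fun _ _ => rfl
  have step : ∀ (g : Pm A) x y, (∀ a ∈ D, g.1 a = a) → p.toFun x = some y →
      p.toFun (g • x) = some (g • y) := by
    intro g x y hg hxy
    obtain ⟨hx, rfl⟩ := (hp _ _).1 hxy
    refine (hp _ _).2 ⟨?_, hfix g x hg⟩
    rw [supp_smul g (Sig.nominal x), Set.disjoint_left]
    rintro a ha ⟨b, hb, hba⟩
    have : b = a := g.2.2.1 (hba.trans (hg a ha).symm)
    exact Set.disjoint_left.1 hx ha (this ▸ hb)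
  obtain ⟨q, hq, hpq⟩ := exists_isSeparating_extension Sig.nominal
    ((forgetFunctor A).obj Y).nominal p hD (isSupport_of_fix fun g hg =>
      PartialMap.ext_some fun x y => by
        rw [PartialMap.smul_eq_some]
        refine ⟨fun h => ?_, step g⁻¹ x y (inv_apply_of_fix hg)⟩
        have := step g _ _ hg h
        rwa [smul_inv_smul, smul_inv_smul] at this)
    (fun x => ⟨fun ⟨y, hy⟩ => ((hp x y).1 hy).1, fun hx => ⟨_, (hp x _).2 ⟨hx, rfl⟩⟩⟩)
  exact ⟨⟨q, hq⟩, D, hD, fun x hx => hpq x _ ((hp x _).2 ⟨hx, rfl⟩)⟩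

/-! ### The equivariant map induced by a separating function -/

/-- The graph of the equivariant map on `Sb A × F Sig` induced by a separating function `q`: the
value at `(m, [n, x])` is `k • q (h • x)`, where `h • x` is separated from `q`, and `k` extends
both `m` on the support of `q` and `n * h⁻¹` on the support of `h • x`. -/
def InducedRel (q : (wand Sig ((forgetFunctor A).obj Y)).carrier) (m n : Sb A) (x : Sig.carrier)
    (y : Y.carrier) : Prop :=
  ∃ (h : Pm A) (k : Sb A) (w : ((forgetFunctor A).obj Y).carrier),
    q.1.toFun (h • x) = some w ∧ (∀ a ∈ supp (Pm A) q.1, k.1 a = m.1 a) ∧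
    (∀ a ∈ supp (Pm A) x, k.1 (h.1 a) = n.1 a) ∧ y = k • (show Y.carrier from w)

theorem InducedRel.exists (q : (wand Sig ((forgetFunctor A).obj Y)).carrier) (m n : Sb A)
    (x : Sig.carrier) : ∃ y, InducedRel q m n x y := by
  obtain ⟨h, -, hh⟩ := exists_move Sig.nominal (C := ∅) Set.finite_empty
    (supp_spec q.2.1).1 (x := x) (Set.empty_disjoint _)
  obtain ⟨w, hw⟩ := (q.2.dom_iff Sig.nominal _).2 hh
  refine ⟨_, h, glue (supp (Pm A) q.1) m (n * incl A h⁻¹), w, hw,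
    fun a ha => glue_of_mem _ _ ha, fun a ha => ?_, rfl⟩
  rw [supp_smul h (Sig.nominal x)] at hh
  rw [glue_of_notMem _ _ (Set.disjoint_right.1 hh ⟨a, ha, rfl⟩)]
  exact congrArg n.1 (inv_apply_self h a)

/-- Two renamings `h • x` and `h' • x` differ by a permutation `g` that can be chosen to fix the
support of `q`, so `w' = g • w`. Then `k` and `k' g` agree on a support of `w`. -/
theorem InducedRel.unique {q : (wand Sig ((forgetFunctor A).obj Y)).carrier} {m n : Sb A}
    {x : Sig.carrier} {y y' : Y.carrier} (hy : InducedRel q m n x y)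
    (hy' : InducedRel q m n x y') : y = y' := by
  obtain ⟨h, k, w, hw, hm, hn, rfl⟩ := hy
  obtain ⟨h', k', w', hw', hm', hn', rfl⟩ := hy'
  have hd := (q.2.dom_iff Sig.nominal _).1 ⟨w, hw⟩
  have hd' := (q.2.dom_iff Sig.nominal _).1 ⟨w', hw'⟩
  have hx := supp_spec (Sig.nominal (h • x))
  have hq := supp_spec q.2.1
  have himg : (h' * h⁻¹) • h • x = h' • x := by rw [mul_smul, inv_smul_smul]
  -- The permutation `h' * h⁻¹` may move the support of `q`. Only its restriction to the support of
  -- `h • x` is kept; that set and its image both avoid the support of `q`.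
  obtain ⟨g, g1, g2⟩ := exists_extend hx.1 (supp (Pm A) q.1) (h' * h⁻¹).1
    ((h' * h⁻¹).2.2.1.injOn) hd.symm (by
      rw [← supp_smul _ (Sig.nominal (h • x)), himg]
      exact hd'.symm)
  have e := PartialMap.apply_smul (hq.2.fix g1) hw
  rw [hx.2 g _ g2, himg, hw'] at e
  have e' : (show Y.carrier from w') = incl A g • (show Y.carrier from w) := Option.some.inj e
  have hsub := PartialMap.supp_value Sig.nominal hq.1 hq.2 hw
  rw [e', ← mul_smul]
  refine smul_eq_of_isSupport_Pm Y (hq.1.union hx.1)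
    ((supp_spec (((forgetFunctor A).obj Y).nominal w)).2.mono hsub) ?_
  rintro a (ha | ha)
  · change k.1 a = k'.1 (g.1 a)
    rw [g1 a ha, hm a ha, hm' a ha]
  · change k.1 a = k'.1 (g.1 a)
    rw [g2 a ha]
    rw [supp_smul h (Sig.nominal x)] at ha
    obtain ⟨b, hb, rfl⟩ := ha
    change _ = k'.1 (h'.1 ((h⁻¹).1 (h.1 b)))
    rw [inv_apply_self, hn b hb, hn' b hb]

theorem InducedRel.smul {q : (wand Sig ((forgetFunctor A).obj Y)).carrier} {m n : Sb A}
    {x : Sig.carrier} {y : Y.carrier} (hy : InducedRel q m n x y) (l : Sb A) :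
    InducedRel q (l * m) (l * n) x (l • y) := by
  obtain ⟨h, k, w, hw, hm, hn, rfl⟩ := hy
  exact ⟨h, l * k, w, hw, fun a ha => congrArg l.1 (hm a ha), fun a ha => congrArg l.1 (hn a ha),
    (mul_smul l k _).symm⟩

theorem InducedRel.perm {q : (wand Sig ((forgetFunctor A).obj Y)).carrier} {m n : Sb A} {g : Pm A}
    {x : Sig.carrier} {y : Y.carrier} (hy : InducedRel q m n (g • x) y) :
    InducedRel q m (n * incl A g) x y := by
  obtain ⟨h, k, w, hw, hm, hn, rfl⟩ := hy
  -- The renamed element is unchanged, since `(h * g) • x = h • g • x`; hence `k` and `w` can stay.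
  refine ⟨h * g, k, w, by rw [mul_smul, hw], hm, fun a ha => hn (g.1 a) ?_, rfl⟩
  rw [supp_smul g (Sig.nominal x)]
  exact ⟨a, ha, rfl⟩

theorem InducedRel.congr {q : (wand Sig ((forgetFunctor A).obj Y)).carrier}
    {m m' n n' : Sb A}
    {x : Sig.carrier} {y : Y.carrier} (hy : InducedRel q m n x y)
    (hmm : ∀ a ∈ supp (Pm A) q.1, m.1 a = m'.1 a) (hnn : ∀ a ∈ supp (Pm A) x, n.1 a = n'.1 a) :
    InducedRel q m' n' x y := by
  obtain ⟨h, k, w, hw, hm, hn, rfl⟩ := hy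
  exact ⟨h, k, w, hw, fun a ha => (hm a ha).trans (hmm a ha),
    fun a ha => (hn a ha).trans (hnn a ha), rfl⟩

/-- The function on `Sb A × F Sig` induced by a separating function. -/
noncomputable def inducedFun (q : (wand Sig ((forgetFunctor A).obj Y)).carrier) (m : Sb A) :
    FreeSet (A := A) Sig.carrier → Y.carrier :=
  Quot.lift (fun p => (InducedRel.exists q m p.1 p.2).choose) (by
    intro p p' hpp
    have hp := (InducedRel.exists q m p.1 p.2).choose_spec
    have hp' := (InducedRel.exists q m p'.1 p'.2).choose_spec
    cases hpp with
    | perm n g x => exact hp.perm.unique hp'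
    | supp n n' x C hC hx h =>
      exact (hp.congr (fun _ _ => rfl) fun a ha => h a (supp_subset hC hx ha)).unique hp')

theorem inducedFun_eq {q : (wand Sig ((forgetFunctor A).obj Y)).carrier} {m n : Sb A}
    {x : Sig.carrier} {y : Y.carrier} (h : InducedRel q m n x y) :
    inducedFun q m (FreeSet.mk n x) = y :=
  (InducedRel.exists q m n x).choose_spec.unique h

/-- The induced map is supported by the support of `q`, since its value depends on `m` only there.
-/
theorem exists_represents_left (q : (wand Sig ((forgetFunctor A).obj Y)).carrier) :
    ∃ f : FreeExp Sig Y, Represents f q := by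
  let f : (Sb A × FreeSet (A := A) Sig.carrier) →[Sb A] Y.carrier :=
    ⟨fun p => inducedFun q p.1 p.2, by
      rintro l ⟨m, ⟨n, x⟩⟩
      obtain ⟨y, hy⟩ := InducedRel.exists q m n x
      exact (inducedFun_eq (hy.smul l)).trans (congrArg (l • ·) (inducedFun_eq hy).symm)⟩
  have hq := supp_spec q.2.1
  have hf : IsSupport (Sb A) (supp (Pm A) q.1) f := by
    intro m m' hm
    apply MulActionHom.ext
    rintro ⟨j, ⟨n, x⟩⟩
    obtain ⟨y, hy⟩ := InducedRel.exists q (j * m) n x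
    exact (inducedFun_eq hy).trans (inducedFun_eq (hy.congr (m' := j * m')
      (fun a ha => congrArg j.1 (hm a ha)) fun _ _ => rfl)).symm
  refine ⟨⟨f, _, hq.1, hf⟩, _, hq.1, fun x hx => ?_⟩
  obtain ⟨w, hw⟩ := (q.2.dom_iff Sig.nominal x).2 hx
  rw [hw]
  -- `x` is already separated from `q`, so no renaming is needed.
  refine congrArg some (inducedFun_eq ⟨1, 1, w, ?_, fun _ _ => rfl, fun _ _ => rfl, ?_⟩).symm
  · rw [one_smul, hw]
  · exact (one_smul (Sb A) (show Y.carrier from w)).symm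

/-! ### Equivariance and naturality of the correspondence -/

theorem Represents.smul {f : FreeExp Sig Y} {q : (wand Sig ((forgetFunctor A).obj Y)).carrier}
    (h : Represents f q) (g : Pm A) : Represents (incl A g • f) (g • q) := by
  obtain ⟨D, hD, h⟩ := h
  refine ⟨g.1 '' D, hD.image _, fun x hx => ?_⟩
  have hx' : Disjoint D (supp (Pm A) (g⁻¹ • x)) := by
    rwa [← Set.disjoint_image_iff g.2.2.1, ← supp_smul g (Sig.nominal _), smul_inv_smul]
  -- Equivariance of `f` and `g • [id, g⁻¹ x] = [id, x]`; the right side is `(g • f) (id, [id, x])`.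
  have key : incl A g • f.1 (1, FreeSet.mk 1 (g⁻¹ • x)) = f.1 (1 * incl A g, FreeSet.mk 1 x) := by
    rw [← map_smul]
    change f.1 (incl A g * 1, FreeSet.mk (incl A g * 1) (g⁻¹ • x)) = _
    rw [FreeSet.mk_perm, mul_one, one_mul, ← map_mul, mul_inv_cancel, map_one]
  have key' : g • (show ((forgetFunctor A).obj Y).carrier from
      f.1 (1, FreeSet.mk 1 (g⁻¹ • x))) = f.1 (1 * incl A g, FreeSet.mk 1 x) := key
  have key'' := eq_inv_smul_iff.2 key'
  exact PartialMap.smul_eq_some.2 ((h _ hx').trans (congrArg some key''))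

/-- The bound `D` for `q` still works, because `wandMap` extends the composite of `q` with `t`. -/
theorem Represents.map {Z : NomSet.{u} (Sb A)} {f : FreeExp Sig Y}
    {q : (wand Sig ((forgetFunctor A).obj Y)).carrier} (h : Represents f q) (t : Y ⟶ Z) :
    Represents (NomSet.fn ((expFunctor ((freeFunctor A).obj Sig)).map t) f)
      (wandMap Sig ((forgetFunctor A).map t) q) := by
  obtain ⟨D, hD, h⟩ := h
  exact ⟨D, hD, fun x hx => wandMap_apply Sig ((forgetFunctor A).map t) q (h x hx)⟩

/-- The separating function that represents an element of the exponent. -/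
noncomputable def toWand (f : FreeExp Sig Y) : (wand Sig ((forgetFunctor A).obj Y)).carrier :=
  (exists_represents_right f).choose

theorem represents_toWand (f : FreeExp Sig Y) : Represents f (toWand f) :=
  (exists_represents_right f).choose_spec

/-- The element of the exponent `F Σ → Y` that a separating function from `Σ` to `U Y` represents. -/
noncomputable def fromWand (q : (wand Sig ((forgetFunctor A).obj Y)).carrier) : FreeExp Sig Y :=
  (exists_represents_left q).choose

theorem represents_fromWand (q : (wand Sig ((forgetFunctor A).obj Y)).carrier) :
    Represents (fromWand q) q :=
  (exists_represents_left q).choose_spec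

end WandExponent

/-! ### The natural isomorphism and the theorem -/

variable {A : Type} [Infinite A]

/-- The forgetful functor turns the exponent by a free nominal set into the magic wand. -/
noncomputable def autForgetIso (Sig : NomSet.{u} (Pm A)) (O : NomSet.{u} (Sb A)) :
    autFunctor ((freeFunctor A).obj Sig) O ⋙ forgetFunctor A ≅
      forgetFunctor A ⋙ sepFunctor Sig ((forgetFunctor A).obj O) :=
  -- Both maps are chosen arbitrarily, but each is pinned down by `Represents`; equivariance,
  -- inverse laws and naturality all follow by uniqueness on one side or the other.
  NatIso.ofComponents
    (fun Y =>
      { hom := NomSet.homMk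
          (fun p : O.carrier × FreeExp Sig Y => (p.1, toWand p.2))
          (fun g (p : O.carrier × FreeExp Sig Y) => Prod.ext rfl
            ((represents_toWand _).unique ((represents_toWand p.2).smul g)))
        inv := NomSet.homMk
          (fun p : O.carrier × (wand Sig ((forgetFunctor A).obj Y)).carrier =>
            (p.1, fromWand p.2))
          (fun g (p : O.carrier × (wand Sig ((forgetFunctor A).obj Y)).carrier) => Prod.ext rfl
            ((represents_fromWand _).injective ((represents_fromWand p.2).smul g)))
        hom_inv_id := NomSet.hom_ext fun (p : O.carrier × FreeExp Sig Y) => Prod.ext rfl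
          ((represents_fromWand _).injective (represents_toWand p.2))
        inv_hom_id := NomSet.hom_ext
          fun (p : O.carrier × (wand Sig ((forgetFunctor A).obj Y)).carrier) => Prod.ext rfl
            ((represents_toWand _).unique (represents_fromWand p.2)) })
    (fun {_ _} t => NomSet.hom_ext fun (p : O.carrier × FreeExp Sig _) => Prod.ext rfl
      ((represents_toWand _).unique ((represents_toWand p.2).map t)))

end Nominal

theorem theorem4p12 (A : Type) [Countable A] [Infinite A]
    (Sig : Nominal.NomSet.{u} (Nominal.Pm A)) (O : Nominal.NomSet.{u} (Nominal.Sb A)) :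
    ∃ (Fbar :
          Endofunctor.Coalgebra (Nominal.sepFunctor Sig ((Nominal.forgetFunctor A).obj O)) ⥤
          Endofunctor.Coalgebra (Nominal.autFunctor ((Nominal.freeFunctor A).obj Sig) O))
      (Ubar :
          Endofunctor.Coalgebra (Nominal.autFunctor ((Nominal.freeFunctor A).obj Sig) O) ⥤
          Endofunctor.Coalgebra (Nominal.sepFunctor Sig ((Nominal.forgetFunctor A).obj O)))
      (adj : Fbar ⊣ Ubar),
      -- on carriers and on underlying maps, `Fbar` is `F` and `Ubar` is `U`
      Fbar ⋙ Endofunctor.Coalgebra.forget _ =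
        Endofunctor.Coalgebra.forget _ ⋙ Nominal.freeFunctor A ∧
      Ubar ⋙ Endofunctor.Coalgebra.forget _ =
        Endofunctor.Coalgebra.forget _ ⋙ Nominal.forgetFunctor A ∧
      -- the underlying maps of unit and counit are those of `F ⊣ U`
      (∀ c, (adj.unit.app c).f ≍ (Nominal.freeForgetAdj A).unit.app c.V) ∧
      (∀ d, (adj.counit.app d).f ≍ (Nominal.freeForgetAdj A).counit.app d.V) := by
  exact Endofunctor.Coalgebra.exists_lift_adjunction _ (Nominal.autForgetIso Sig O)
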